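/- Let $n,k$ be integers with $1\le k\le n-1$. A star body in $\mathbb{R}^n$ is a closed bounded set $K$ with the origin in its interior such that every straight line through the origin crosses the boundary of $K$ at exactly two points different from the origin and the boundary of $K$ is continuous, i.e. the radius $r_K(\xi)=\max\{t\ge 0: t\xi\in K\}$ is a continuous function of $\xi\in S^{n-1}$. The radial $k$-sum of finitely many star bodies $K_1,\dots,K_m$ ($m\ge1$) is the star body $L$ with $r_L^k(\xi)=\sum_{i=1}^m r_{K_i}^k(\xi)$ for all $\xi\in S^{n-1}$. The class $\mathcal{BP}_k^n$ of generalized $k$-intersection bodies is the closure, within the origin-symmetric star bodies in $\mathbb{R}^n$ and with respect to the radial metric $\rho(K,L)=\sup_{\xi\in S^{n-1}}|r_K(\xi)-r_L(\xi)|$, of the set of radial $k$-sums of finite nonempty collections of origin-symmetric ellipsoids. For an origin-symmetric star body $K$ put $$\mathrm{o.v.r.}(K,\mathcal{BP}_k^n)=\inf\left\{\left(\frac{|D|}{|K|}\right)^{1/n}:\ K\subset D,\ D\in\mathcal{BP}_k^n\right\},$$ where $|\cdot|$ denotes volume of the appropriate dimension. Let $c_{n,k}=|B_2^n|^{\frac{n-k}{n}}/|B_2^{n-k}|$,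 where $B_2^m$ is the unit Euclidean ball in $\mathbb{R}^m$, and let $Gr_{n-k}$ be the Grassmannian of $(n-k)$-dimensional linear subspaces of $\mathbb{R}^n$. Let $K$ be an origin-symmetric star body in $\mathbb{R}^n$, and let $\mu$ be a measure with non-negative even continuous density $f$ on $K$; write $\mu(K)=\int_K f$ and, for $H\in Gr_{n-k}$, $\mu(K\cap H)=\int_{K\cap H}f$, the integral of the restriction of $f$ to $H$ with respect to Lebesgue measure in $H$. Then the maximum of $\mu(K\cap H)$ over $H\in Gr_{n-k}$ is attained, and $$\mu(K)\ \le\ \left(\mathrm{o.v.r.}(K,\mathcal{BP}_k^n)\right)^k\ \frac{n}{n-k}\ c_{n,k}\ \max_{H\in Gr_{n-k}}\mu(K\cap H)\ |K|^{k/n}.$$ -/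

import Mathlib

open Set MeasureTheory Metric

noncomputable section

/-- Euclidean space `ℝⁿ`. -/
abbrev Euc (n : ℕ) : Type := EuclideanSpace ℝ (Fin n)

/-- The radius `r_K(ξ)` of `K` in the direction `ξ`. -/
def radialFunction {n : ℕ} (K : Set (Euc n)) (ξ : Euc n) : ℝ :=
  sSup {t : ℝ | 0 ≤ t ∧ t • ξ ∈ K}

/-- A star body: a closed bounded set with the origin in its interior, such that every straight line
through the origin meets the boundary in exactly two points different from the origin, and whose
boundary is continuous (the radius is a continuous function of the direction). -/
structure IsStarBody {n : ℕ} (K : Set (Euc n)) : Prop where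
  isClosed : IsClosed K
  isBounded : Bornology.IsBounded K
  zero_mem_interior : (0 : Euc n) ∈ interior K
  line_boundary : ∀ ξ : Euc n, ξ ≠ 0 →
    {x : Euc n | x ∈ frontier K ∧ x ≠ 0 ∧ ∃ t : ℝ, x = t • ξ}.ncard = 2
  continuous_boundary : ContinuousOn (radialFunction K) (sphere (0 : Euc n) 1)

/-- An origin-symmetric star body. -/
def IsSymmStarBody {n : ℕ} (K : Set (Euc n)) : Prop :=
  IsStarBody K ∧ ∀ x ∈ K, -x ∈ K

/-- An origin-symmetric (solid, nondegenerate) ellipsoid. -/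
def IsSymmEllipsoid {n : ℕ} (K : Set (Euc n)) : Prop :=
  ∃ T : Euc n ≃ₗ[ℝ] Euc n, K = T '' closedBall (0 : Euc n) 1

/-- `L` is the radial `k`-sum of the finite family `E 0, …, E (m - 1)`: the star body whose radius
in each direction satisfies `r_L(ξ)^k = ∑ i, r_{E i}(ξ)^k`. -/
def IsRadialSum {n : ℕ} (k : ℕ) {m : ℕ} (E : Fin m → Set (Euc n)) (L : Set (Euc n)) : Prop :=
  IsStarBody L ∧ ∀ ξ ∈ sphere (0 : Euc n) 1,
    radialFunction L ξ ^ k = ∑ i, radialFunction (E i) ξ ^ k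

/-- The radial metric `ρ(K, L)`, the supremum over the unit sphere of `|r_K - r_L|`. -/
def radialDist {n : ℕ} (K L : Set (Euc n)) : ℝ :=
  ⨆ ξ : sphere (0 : Euc n) 1, |radialFunction K ξ - radialFunction L ξ|

/-- The class `BP_k^n` of generalized `k`-intersection bodies: the closure, in the radial metric on
origin-symmetric star bodies, of the radial `k`-sums of finite (nonempty) collections of
origin-symmetric ellipsoids. -/
def IsGenIntersectionBody {n : ℕ} (k : ℕ) (D : Set (Euc n)) : Prop :=
  IsSymmStarBody D ∧ ∀ ε : ℝ, 0 < ε →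
    ∃ (m : ℕ) (E : Fin m → Set (Euc n)) (L : Set (Euc n)),
      0 < m ∧ (∀ i, IsSymmEllipsoid (E i)) ∧ IsRadialSum k E L ∧ radialDist D L < ε

/-- The volume `|A|` of a subset of `ℝⁿ`, as a real number. -/
def vol {n : ℕ} (A : Set (Euc n)) : ℝ := (volume A).toReal

/-- The outer volume ratio distance from `K` to the class `BP_k^n`. -/
def outerVolumeRatio {n : ℕ} (k : ℕ) (K : Set (Euc n)) : ℝ :=
  sInf {v : ℝ | ∃ D : Set (Euc n), K ⊆ D ∧ IsGenIntersectionBody k D ∧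
    v = (vol D / vol K) ^ (1 / (n : ℝ))}

/-- The constant `c_{n,k} = |B_2^n|^((n-k)/n) / |B_2^(n-k)|`. -/
def cConst (n k : ℕ) : ℝ :=
  vol (closedBall (0 : Euc n) 1) ^ (((n : ℝ) - (k : ℝ)) / (n : ℝ)) /
    vol (closedBall (0 : Euc (n - k)) 1)

/-- `μ(B) = ∫_B f`, for the measure `μ` with density `f`. -/
def densityMeasure {n : ℕ} (f : Euc n → ℝ) (B : Set (Euc n)) : ℝ :=
  ∫ x in B, f x

/-- Lebesgue measure in a subspace `H`: the Haar measure giving mass one to the cube spanned by an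
orthonormal basis of `H`. (It is spelled out because `volume` on the subtype `H` could also be read
as the restriction of the ambient volume.) -/
def subspaceVolume {n : ℕ} (H : Submodule ℝ (Euc n)) : Measure H :=
  (stdOrthonormalBasis ℝ H).toBasis.addHaar

/-- `μ(B ∩ H) = ∫_{B ∩ H} f`, the integral over `B ∩ H` of the restriction of `f` to `H` with
respect to Lebesgue measure in `H`. -/
def sectionMeasure {n : ℕ} (f : Euc n → ℝ) (B : Set (Euc n)) (H : Submodule ℝ (Euc n)) : ℝ :=
  ∫ x in {x : H | (x : Euc n) ∈ B}, f x ∂(subspaceVolume H)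

end

/-!
Let `K ⊆ D` with `D` a generalized `k`-intersection body. The radial function of `D`, extended by
homogeneity of degree `-1`, is at least `1` on `K ∖ {0}`, so `μ(K) ≤ ∫ r_D^k F` with `F = f · 1_K`.
For an ellipsoid `T(B)` we have `r^k = ‖T⁻¹ x‖^(-k)`, and by polar coordinates integration against
`‖y‖^(-k)` on `ℝⁿ` is a constant times the average over the orthogonal group of the integrals over
rotated `(n - k)`-dimensional subspaces. Comparing `F` with the indicator of the unit ball `B_n`
subspace by subspace, where the Jacobians of `T` restricted to a subspace cancel, gives
`|B_{n-k}| ∫ r^k F ≤ max_H μ(K ∩ H) ∫_{B_n} r^k`. This is additive in `r^k` and stable under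
radial limits, hence holds for `D`; polar coordinates and Hölder's inequality on the sphere bound
`(n - k) ∫_{B_n} r_D^k` by `n |B_n|^((n-k)/n) |D|^(k/n)`, and the infimum over `D` produces the
outer volume ratio.

The maximum is attained because the orthogonal group is compact and `U ↦ ∫_{U H} F` is continuous
by dominated convergence: strict star-shapedness, `t K ⊆ interior K` for `0 ≤ t < 1`, makes the
boundary of `K`, where `F` may jump, a null set in every subspace.
-/

noncomputable section

open Filter
open Module (finrank)
open scoped ENNReal Pointwise Topology

section StarBody

variable {n : ℕ} {K : Set (Euc n)} {x : Euc n} {t : ℝ}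

theorem radialFunction_zero : radialFunction K 0 = 0 := by
  by_cases h : (0 : Euc n) ∈ K
  · have : {t : ℝ | 0 ≤ t ∧ t • (0 : Euc n) ∈ K} = Ici 0 := by ext t; simp [h]
    rw [radialFunction, this, Real.sSup_of_not_bddAbove (not_bddAbove_Ici 0)]
  · simp [radialFunction, h]

theorem radialFunction_nonneg (K : Set (Euc n)) (x : Euc n) : 0 ≤ radialFunction K x :=
  Real.sSup_nonneg fun _ ht => ht.1

theorem radialFunction_smul (ht : 0 < t) (x : Euc n) :
    radialFunction K (t • x) = t⁻¹ * radialFunction K x := by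
  unfold radialFunction
  rw [← smul_eq_mul, ← Real.sSup_smul_of_nonneg (inv_nonneg.2 ht.le)]
  congr 1
  ext s
  rw [Set.mem_inv_smul_set_iff₀ ht.ne']
  simp only [mem_ofPred_eq, smul_smul, smul_eq_mul, mul_comm t s, mul_nonneg_iff_of_pos_right ht]

theorem radialFunction_eq_inv_norm_mul (hx : x ≠ 0) :
    radialFunction K x = ‖x‖⁻¹ * radialFunction K (‖x‖⁻¹ • x) := by
  have hx' : 0 < ‖x‖ := norm_pos_iff.2 hx
  rw [← radialFunction_smul hx', smul_smul, mul_inv_cancel₀ hx'.ne', one_smul]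

theorem inv_norm_smul_mem_sphere {E : Type*} [NormedAddCommGroup E] [NormedSpace ℝ E] {x : E}
    (hx : x ≠ 0) : ‖x‖⁻¹ • x ∈ sphere (0 : E) 1 := by
  rw [mem_sphere_zero_iff_norm, norm_smul, norm_inv, norm_norm,
    inv_mul_cancel₀ (norm_ne_zero_iff.2 hx)]

namespace IsStarBody

theorem isCompact (hK : IsStarBody K) : IsCompact K :=
  isCompact_of_isClosed_isBounded hK.isClosed hK.isBounded

theorem isGreatest_radialFunction (hK : IsStarBody K) (hx : x ≠ 0) :
    IsGreatest {t : ℝ | 0 ≤ t ∧ t • x ∈ K} (radialFunction K x) := by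
  have hclosed : IsClosed {t : ℝ | 0 ≤ t ∧ t • x ∈ K} :=
    isClosed_Ici.inter (hK.isClosed.preimage (continuous_id.smul continuous_const))
  have hbdd : BddAbove {t : ℝ | 0 ≤ t ∧ t • x ∈ K} := by
    obtain ⟨R, hR⟩ := hK.isBounded.exists_norm_le
    refine ⟨R / ‖x‖, fun t ht => (le_div_iff₀ (norm_pos_iff.2 hx)).2 ?_⟩
    simpa only [norm_smul, Real.norm_of_nonneg ht.1] using hR _ ht.2
  have hzero : 0 ≤ (0 : ℝ) ∧ (0 : ℝ) • x ∈ K :=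
    ⟨le_rfl, by simpa only [zero_smul] using interior_subset hK.zero_mem_interior⟩
  exact ⟨hclosed.csSup_mem ⟨0, hzero⟩ hbdd, fun t ht => le_csSup hbdd ht⟩

theorem lt_radialFunction_of_smul_mem_interior (hK : IsStarBody K) (hx : x ≠ 0) (ht : 0 ≤ t)
    (h : t • x ∈ interior K) : t < radialFunction K x := by
  have hnear : ∀ᶠ s in 𝓝 t, s • x ∈ interior K :=
    (continuous_id.smul continuous_const).continuousAt.eventually_mem
      (isOpen_interior.mem_nhds h)
  obtain ⟨s, hts, hs⟩ := hnear.exists_gt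
  exact hts.trans_le
    ((hK.isGreatest_radialFunction hx).2 ⟨ht.trans hts.le, interior_subset hs⟩)

theorem radialFunction_pos (hK : IsStarBody K) (hx : x ≠ 0) : 0 < radialFunction K x :=
  hK.lt_radialFunction_of_smul_mem_interior hx le_rfl
    (by simpa only [zero_smul] using hK.zero_mem_interior)

theorem radialFunction_smul_mem_frontier (hK : IsStarBody K) (hx : x ≠ 0) :
    radialFunction K x • x ∈ frontier K := by
  have hr := (hK.isGreatest_radialFunction hx).1
  rw [hK.isClosed.frontier_eq]
  exact ⟨hr.2, fun hint =>
    lt_irrefl _ (hK.lt_radialFunction_of_smul_mem_interior hx hr.1 hint)⟩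

theorem smul_mem_frontier_iff (hK : IsStarBody K) (hx : x ≠ 0) (ht : 0 < t) :
    t • x ∈ frontier K ↔ t = radialFunction K x := by
  refine ⟨fun h => ?_, fun h => h ▸ hK.radialFunction_smul_mem_frontier hx⟩
  set r := radialFunction K x
  set r' := radialFunction K (-x)
  have hr : 0 < r := hK.radialFunction_pos hx
  have hr' : 0 < r' := hK.radialFunction_pos (neg_ne_zero.2 hx)
  have hinj : Function.Injective fun s : ℝ => s • x := smul_left_injective ℝ hx
  have hsub : {r • x, (-r') • x} ⊆
      {y : Euc n | y ∈ frontier K ∧ y ≠ 0 ∧ ∃ s : ℝ, y = s • x} := by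
    rintro _ (rfl | rfl)
    · exact ⟨hK.radialFunction_smul_mem_frontier hx, smul_ne_zero hr.ne' hx, r, rfl⟩
    · refine ⟨?_, smul_ne_zero (neg_ne_zero.2 hr'.ne') hx, -r', rfl⟩
      simpa only [neg_smul, smul_neg] using
        hK.radialFunction_smul_mem_frontier (neg_ne_zero.2 hx)
  have hpair : ({r • x, (-r') • x} : Set (Euc n)).ncard = 2 :=
    Set.ncard_pair (hinj.ne (by linarith))
  have htwo := hK.line_boundary x hx
  have heq := Set.eq_of_subset_of_ncard_le hsub (by rw [htwo, hpair])
    (Set.finite_of_ncard_ne_zero (by rw [htwo]; norm_num))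
  have hmem : t • x ∈ ({r • x, (-r') • x} : Set (Euc n)) := by
    rw [heq]
    exact ⟨h, smul_ne_zero ht.ne' hx, t, rfl⟩
  rcases hmem with h | h
  · exact hinj h
  · linarith [hinj h]

theorem smul_mem_interior_of_lt (hK : IsStarBody K) (hx : x ≠ 0) (ht : 0 ≤ t)
    (h : t < radialFunction K x) : t • x ∈ interior K := by
  have hconn : IsPreconnected ((fun s : ℝ => s • x) '' Icc 0 t) :=
    isPreconnected_Icc.image _ (continuous_id.smul continuous_const).continuousOn
  refine hconn.subset_of_closure_inter_subset isOpen_interior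
    ⟨0, ⟨0, ⟨le_rfl, ht⟩, zero_smul ℝ x⟩, hK.zero_mem_interior⟩ ?_ ⟨t, ⟨ht, le_rfl⟩, rfl⟩
  rintro _ ⟨hs, ⟨s, ⟨hs₀, hst⟩, rfl⟩⟩
  rcases hs₀.eq_or_lt with rfl | hpos
  · simpa only [zero_smul] using hK.zero_mem_interior
  · by_contra hint
    have hfr : s • x ∈ frontier K := ⟨closure_mono interior_subset hs, hint⟩
    exact (hst.trans_lt h).ne ((hK.smul_mem_frontier_iff hx hpos).1 hfr)

theorem smul_mem_iff (hK : IsStarBody K) (hx : x ≠ 0) (ht : 0 ≤ t) :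
    t • x ∈ K ↔ t ≤ radialFunction K x := by
  refine ⟨fun h => (hK.isGreatest_radialFunction hx).2 ⟨ht, h⟩, fun h => ?_⟩
  rcases h.eq_or_lt with rfl | h
  · exact (hK.isGreatest_radialFunction hx).1.2
  · exact interior_subset (hK.smul_mem_interior_of_lt hx ht h)

theorem one_le_radialFunction (hK : IsStarBody K) (hx : x ≠ 0) (hxK : x ∈ K) :
    1 ≤ radialFunction K x :=
  (hK.smul_mem_iff hx zero_le_one).1 (by rwa [one_smul])

theorem smul_subset_interior (hK : IsStarBody K) (ht : t ∈ Ioo (0 : ℝ) 1) :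
    t • K ⊆ interior K := by
  rintro _ ⟨x, hx, rfl⟩
  rcases eq_or_ne x 0 with rfl | hx₀
  · simpa only [smul_zero] using hK.zero_mem_interior
  · exact hK.smul_mem_interior_of_lt hx₀ ht.1.le
      (ht.2.trans_le (hK.one_le_radialFunction hx₀ hx))

theorem continuousOn_radialFunction (hK : IsStarBody K) :
    ContinuousOn (radialFunction K) {0}ᶜ := by
  have hinv : ContinuousOn (fun x : Euc n => ‖x‖⁻¹) {0}ᶜ :=
    continuous_norm.continuousOn.inv₀ fun x hx => norm_ne_zero_iff.2 hx
  exact (hinv.mul (hK.continuous_boundary.comp (hinv.smul continuousOn_id)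
    fun x hx => inv_norm_smul_mem_sphere hx)).congr fun x hx => radialFunction_eq_inv_norm_mul hx

theorem measurable_radialFunction (hK : IsStarBody K) : Measurable (radialFunction K) :=
  measurable_of_continuousOn_compl_singleton 0 hK.continuousOn_radialFunction

theorem exists_pos_le_radialFunction (hK : IsStarBody K) :
    ∃ δ > 0, ∀ ξ ∈ sphere (0 : Euc n) 1, δ ≤ radialFunction K ξ := by
  rcases (sphere (0 : Euc n) 1).eq_empty_or_nonempty with h | h
  · exact ⟨1, one_pos, by simp [h]⟩
  · obtain ⟨ξ, hξ, hmin⟩ := (isCompact_sphere (0 : Euc n) 1).exists_isMinOn h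
      hK.continuous_boundary
    exact ⟨_, hK.radialFunction_pos (ne_zero_of_mem_unit_sphere ⟨ξ, hξ⟩), fun η hη => hmin hη⟩

end IsStarBody

section RadialDist

variable {D L : Set (Euc n)}

theorem abs_radialFunction_sub_le_radialDist (hD : IsStarBody D) (hL : IsStarBody L)
    (hx : x ∈ sphere (0 : Euc n) 1) :
    |radialFunction D x - radialFunction L x| ≤ radialDist D L := by
  have hcont : Continuous fun ξ : sphere (0 : Euc n) 1 =>
      |radialFunction D ξ - radialFunction L ξ| :=
    (hD.continuous_boundary.domRestrict.sub hL.continuous_boundary.domRestrict).abs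
  exact le_ciSup (isCompact_range hcont).bddAbove ⟨x, hx⟩

theorem IsStarBody.exists_radialDist_lt_imp_le_mul (hD : IsStarBody D) {c : ℝ} (hc : 1 < c) :
    ∃ ε > 0, ∀ L : Set (Euc n), IsStarBody L → radialDist D L < ε → ∀ x,
      radialFunction D x ≤ c * radialFunction L x ∧
        radialFunction L x ≤ c * radialFunction D x := by
  obtain ⟨δ, hδ, hδD⟩ := hD.exists_pos_le_radialFunction
  refine ⟨(1 - c⁻¹) * δ, mul_pos (sub_pos.2 (inv_lt_one_of_one_lt₀ hc)) hδ,
    fun L hL hdist x => ?_⟩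
  rcases eq_or_ne x 0 with rfl | hx
  · simp only [radialFunction_zero, mul_zero, le_refl, and_self]
  have hξ := inv_norm_smul_mem_sphere hx
  rw [radialFunction_eq_inv_norm_mul hx, radialFunction_eq_inv_norm_mul (K := L) hx,
    mul_left_comm c, mul_left_comm c]
  set ξ := ‖x‖⁻¹ • x
  obtain ⟨hlower, hupper⟩ :=
    abs_le.1 ((abs_radialFunction_sub_le_radialDist hD hL hξ).trans hdist.le)
  have hbound : (1 - c⁻¹) * δ ≤ (1 - c⁻¹) * radialFunction D ξ :=
    mul_le_mul_of_nonneg_left (hδD ξ hξ) (sub_nonneg.2 (inv_le_one_of_one_le₀ hc.le))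
  have hc_two : 2 - c⁻¹ ≤ c := by
    rw [sub_le_iff_le_add]
    field_simp
    linarith [sq_nonneg (c - 1)]
  constructor <;> refine mul_le_mul_of_nonneg_left ?_ (inv_nonneg.2 (norm_nonneg x))
  · exact (inv_mul_le_iff₀ (by positivity)).1 (by linarith)
  · calc radialFunction L ξ ≤ (2 - c⁻¹) * radialFunction D ξ := by linarith
      _ ≤ c * radialFunction D ξ := mul_le_mul_of_nonneg_right hc_two (hδ.le.trans (hδD ξ hξ))

end RadialDist

end StarBody

section Ellipsoid

variable {n k : ℕ}

theorem radialFunction_image_closedBall (T : Euc n ≃ₗ[ℝ] Euc n) (x : Euc n) :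
    radialFunction (T '' closedBall (0 : Euc n) 1) x = ‖T.symm x‖⁻¹ := by
  rcases eq_or_ne x 0 with rfl | hx
  · rw [radialFunction_zero, map_zero, norm_zero, inv_zero]
  have hpos : 0 < ‖T.symm x‖ := norm_pos_iff.2 (T.symm.map_ne_zero_iff.2 hx)
  have : {t : ℝ | 0 ≤ t ∧ t • x ∈ T '' closedBall (0 : Euc n) 1} = Icc 0 ‖T.symm x‖⁻¹ := by
    ext t
    simp only [mem_ofPred_eq, mem_Icc, and_congr_right_iff]
    intro ht
    rw [LinearEquiv.image_eq_preimage_symm, mem_preimage, map_smul, mem_closedBall_zero_iff,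
      norm_smul, Real.norm_of_nonneg ht, ← one_div, le_div_iff₀ hpos]
  rw [radialFunction, this, csSup_Icc (inv_nonneg.2 hpos.le)]

theorem closedBall_eq_image_smulOfNeZero {R : ℝ} (hR : 0 < R) :
    closedBall (0 : Euc n) R =
      LinearEquiv.smulOfNeZero ℝ (Euc n) R hR.ne' '' closedBall (0 : Euc n) 1 := by
  rw [← smul_unitClosedBall_of_nonneg hR.le, ← Set.image_smul]
  rfl

theorem radialFunction_closedBall {R : ℝ} (hR : 0 < R) {ξ : Euc n}
    (hξ : ξ ∈ sphere (0 : Euc n) 1) : radialFunction (closedBall (0 : Euc n) R) ξ = R := by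
  rw [closedBall_eq_image_smulOfNeZero hR, radialFunction_image_closedBall]
  change ‖R⁻¹ • ξ‖⁻¹ = R
  rw [norm_smul, mem_sphere_zero_iff_norm.1 hξ, mul_one, norm_inv, inv_inv,
    Real.norm_of_nonneg hR.le]

theorem ncard_sphere_inter_line {E : Type*} [NormedAddCommGroup E] [NormedSpace ℝ E] {R : ℝ}
    (hR : 0 < R) {ξ : E} (hξ : ξ ≠ 0) :
    {x : E | x ∈ sphere (0 : E) R ∧ ∃ t : ℝ, x = t • ξ}.ncard = 2 := by
  have hξ' : 0 < ‖ξ‖ := norm_pos_iff.2 hξ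
  have hpos : 0 < R / ‖ξ‖ := div_pos hR hξ'
  have hpair : {x : E | x ∈ sphere (0 : E) R ∧ ∃ t : ℝ, x = t • ξ} =
      {(R / ‖ξ‖) • ξ, (-(R / ‖ξ‖)) • ξ} := by
    ext x
    simp only [mem_ofPred_eq, mem_insert_iff, mem_singleton_iff, mem_sphere_zero_iff_norm]
    constructor
    · rintro ⟨hx, t, rfl⟩
      rw [norm_smul, Real.norm_eq_abs, ← eq_div_iff hξ'.ne'] at hx
      exact (eq_or_eq_neg_of_abs_eq hx).imp (by rw [·]) (by rw [·])
    · rintro (rfl | rfl) <;> refine ⟨?_, _, rfl⟩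
      · rw [norm_smul, Real.norm_of_nonneg hpos.le, div_mul_cancel₀ _ hξ'.ne']
      · rw [norm_smul, norm_neg, Real.norm_of_nonneg hpos.le, div_mul_cancel₀ _ hξ'.ne']
  rw [hpair]
  exact Set.ncard_pair ((smul_left_injective ℝ hξ).ne (by linarith))

theorem isSymmStarBody_closedBall {R : ℝ} (hR : 0 < R) :
    IsSymmStarBody (closedBall (0 : Euc n) R) where
  left :=
    { isClosed := isClosed_closedBall
      isBounded := isBounded_closedBall
      zero_mem_interior := by
        rw [interior_closedBall _ hR.ne']
        exact mem_ball_self hR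
      line_boundary := fun ξ hξ => by
        rw [← ncard_sphere_inter_line hR hξ, frontier_closedBall _ hR.ne']
        congr 1 with x
        exact and_congr_right fun hx => and_iff_right (ne_of_mem_sphere hx hR.ne')
      continuous_boundary := continuousOn_const.congr fun ξ hξ => radialFunction_closedBall hR hξ }
  right x hx := by rwa [mem_closedBall_zero_iff, norm_neg, ← mem_closedBall_zero_iff]

theorem isGenIntersectionBody_closedBall (k : ℕ) {R : ℝ} (hR : 0 < R) :
    IsGenIntersectionBody k (closedBall (0 : Euc n) R) := by
  refine ⟨isSymmStarBody_closedBall hR, fun ε hε => ⟨1, fun _ => closedBall 0 R, closedBall 0 R,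
    one_pos, fun _ => ⟨_, closedBall_eq_image_smulOfNeZero hR⟩,
    ⟨(isSymmStarBody_closedBall hR).1, fun ξ _ => by rw [Fin.sum_univ_one]⟩, ?_⟩⟩
  simpa only [radialDist, sub_self, abs_zero, Real.iSup_const_zero] using hε

theorem IsSymmEllipsoid.measurable_radialFunction {E : Set (Euc n)}
    (hE : IsSymmEllipsoid E) : Measurable (radialFunction E) := by
  obtain ⟨T, rfl⟩ := hE
  rw [funext (radialFunction_image_closedBall T)]
  exact T.symm.toContinuousLinearEquiv.continuous.measurable.norm.inv

theorem IsRadialSum.radialFunction_pow (hk : k ≠ 0) {m : ℕ} {E : Fin m → Set (Euc n)}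
    {L : Set (Euc n)} (hL : IsRadialSum k E L) (x : Euc n) :
    radialFunction L x ^ k = ∑ i, radialFunction (E i) x ^ k := by
  rcases eq_or_ne x 0 with rfl | hx
  · simp only [radialFunction_zero, zero_pow hk, Finset.sum_const_zero]
  · rw [radialFunction_eq_inv_norm_mul hx, mul_pow, hL.2 _ (inv_norm_smul_mem_sphere hx),
      Finset.mul_sum]
    simp only [← mul_pow, ← radialFunction_eq_inv_norm_mul hx]

end Ellipsoid

section LinearMaps

variable {E F : Type*} [NormedAddCommGroup E] [InnerProductSpace ℝ E]
  [NormedAddCommGroup F] [InnerProductSpace ℝ F]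

theorem nonempty_linearIsometryEquiv_of_finrank_eq [FiniteDimensional ℝ E]
    [FiniteDimensional ℝ F] (h : finrank ℝ F = finrank ℝ E) :
    Nonempty (F ≃ₗᵢ[ℝ] E) :=
  ⟨(stdOrthonormalBasis ℝ F).equiv (stdOrthonormalBasis ℝ E) (finCongr h)⟩

theorem nonempty_linearIsometry_of_finrank_le [FiniteDimensional ℝ E]
    [FiniteDimensional ℝ F] (h : finrank ℝ F ≤ finrank ℝ E) : Nonempty (F →ₗᵢ[ℝ] E) := by
  set b := stdOrthonormalBasis ℝ F
  set v : Fin (finrank ℝ F) → E := stdOrthonormalBasis ℝ E ∘ Fin.castLE h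
  have hv : Orthonormal ℝ v :=
    (stdOrthonormalBasis ℝ E).orthonormal.comp _ (Fin.castLE_injective h)
  refine ⟨(b.toBasis.constr ℝ v).isometryOfOrthonormal (v := b.toBasis)
    (by simpa only [b.coe_toBasis] using b.orthonormal) ?_⟩
  convert hv using 1
  exact funext fun i => b.toBasis.constr_basis ℝ v i

theorem exists_range_linearIsometry_eq [FiniteDimensional ℝ E] [FiniteDimensional ℝ F]
    (H : Submodule ℝ E) (hH : finrank ℝ H = finrank ℝ F) :
    ∃ V : F →ₗᵢ[ℝ] E, LinearMap.range V.toLinearMap = H := by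
  obtain ⟨L⟩ := nonempty_linearIsometryEquiv_of_finrank_eq hH.symm
  refine ⟨H.subtypeₗᵢ.comp L.toLinearIsometry, ?_⟩
  change LinearMap.range (H.subtype ∘ₗ L.toLinearEquiv.toLinearMap) = H
  rw [LinearEquiv.range_comp, Submodule.range_subtype]

theorem exists_linearIsometry_comp_linearEquiv_eq [FiniteDimensional ℝ F] {A : F →ₗ[ℝ] E}
    (hA : Function.Injective A) :
    ∃ (V : F →ₗᵢ[ℝ] E) (B : F ≃ₗ[ℝ] F), ∀ y, A y = V (B y) := by
  obtain ⟨L⟩ := nonempty_linearIsometryEquiv_of_finrank_eq (LinearMap.finrank_range_of_inj hA).symm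
  refine ⟨(LinearMap.range A).subtypeₗᵢ.comp L.toLinearIsometry,
    (LinearEquiv.ofInjective A hA).trans L.symm.toLinearEquiv, fun y => ?_⟩
  change A y = L (L.symm (LinearEquiv.ofInjective A hA y))
  rw [L.apply_symm_apply, LinearEquiv.ofInjective_apply]

theorem exists_linearIsometryEquiv_apply_eq {x y : E} (h : ‖x‖ = ‖y‖) :
    ∃ e : E ≃ₗᵢ[ℝ] E, e x = y :=
  ⟨(ℝ ∙ (x - y))ᗮ.reflection, Submodule.reflection_sub h⟩

theorem exists_linearIsometryEquiv_comp_eq [FiniteDimensional ℝ E] (V W : F →ₗᵢ[ℝ] E) :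
    ∃ e : E ≃ₗᵢ[ℝ] E, ∀ y, e (W y) = V y := by
  set L : LinearMap.range W.toLinearMap →ₗᵢ[ℝ] E := V.comp W.equivRange.symm.toLinearIsometry
  refine ⟨L.extend.toLinearIsometryEquiv rfl, fun y => ?_⟩
  calc L.extend (W y) = L (W.equivRange y) := L.extend_apply (W.equivRange y)
    _ = V y := congrArg V (W.equivRange.symm_apply_apply y)

end LinearMaps

section LinearChangeOfVariables

variable {E : Type*} [NormedAddCommGroup E] [NormedSpace ℝ E] [FiniteDimensional ℝ E]
  [MeasurableSpace E] [BorelSpace E] (μ : Measure E) [μ.IsAddHaarMeasure]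

theorem lintegral_comp_linearEquiv (T : E ≃ₗ[ℝ] E) (g : E → ℝ≥0∞) :
    ∫⁻ x, g (T x) ∂μ =
      ENNReal.ofReal |(LinearMap.det (T : E →ₗ[ℝ] E))⁻¹| * ∫⁻ x, g x ∂μ := by
  rw [← smul_eq_mul, ← lintegral_smul_measure,
    ← Measure.map_linearMap_addHaar_eq_smul_addHaar μ T.isUnit_det'.ne_zero]
  exact (lintegral_map_equiv (μ := μ) g
    T.toContinuousLinearEquiv.toHomeomorph.toMeasurableEquiv).symm

theorem addHaar_sdiff_eq_zero_of_smul_subset {C O : Set E} (hOC : O ⊆ C)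
    (hO : NullMeasurableSet O μ) (hC : μ C ≠ ∞)
    (h : ∀ t ∈ Ioo (0 : ℝ) 1, t • C ⊆ O) : μ (C \ O) = 0 := by
  have hle : ∀ t ∈ Ioo (0 : ℝ) 1, ENNReal.ofReal (t ^ finrank ℝ E) * μ C ≤ μ O := fun t ht => by
    rw [← Measure.addHaar_smul_of_nonneg μ ht.1.le]
    exact measure_mono (h t ht)
  have hlim : Tendsto (fun t : ℝ => ENNReal.ofReal (t ^ finrank ℝ E) * μ C) (𝓝[<] 1)
      (𝓝 (ENNReal.ofReal (1 ^ finrank ℝ E) * μ C)) :=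
    ENNReal.Tendsto.mul_const (((ENNReal.continuous_ofReal.comp
      (continuous_pow _)).tendsto 1).mono_left nhdsWithin_le_nhds) (Or.inr hC)
  rw [one_pow, ENNReal.ofReal_one, one_mul] at hlim
  have hCO : μ C ≤ μ O :=
    le_of_tendsto hlim (eventually_of_mem (Ioo_mem_nhdsLT zero_lt_one) hle)
  rw [measure_sdiff hOC hO (ne_top_of_le_ne_top hC (measure_mono hOC)), tsub_eq_zero_of_le hCO]

theorem IsStarBody.ae_notMem_frontier_comp {n : ℕ} {K : Set (Euc n)} (hK : IsStarBody K)
    {A : E →ₗ[ℝ] Euc n} (hA : Function.Injective A) : ∀ᵐ y ∂μ, A y ∉ frontier K := by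
  have hAc : Continuous A := A.continuous_of_finiteDimensional
  have hfinite : μ (A ⁻¹' K) ≠ ∞ := by
    obtain ⟨_, -, hanti⟩ := A.toContinuousLinearMap.exists_antilipschitzWith
      (LinearMap.ker_eq_bot.2 hA)
    exact (hanti.isBounded_preimage hK.isBounded).measure_lt_top.ne
  have hnull : μ (A ⁻¹' K \ A ⁻¹' interior K) = 0 := by
    refine addHaar_sdiff_eq_zero_of_smul_subset μ (preimage_mono interior_subset)
      (isOpen_interior.preimage hAc).nullMeasurableSet hfinite fun t ht => ?_
    rintro _ ⟨y, hy, rfl⟩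
    change A (t • y) ∈ interior K
    rw [map_smul]
    exact hK.smul_subset_interior ht (smul_mem_smul_set hy)
  rw [ae_iff]
  simp only [not_not, hK.isClosed.frontier_eq]
  exact hnull

end LinearChangeOfVariables

section Sections

variable {n : ℕ} {K : Set (Euc n)} {F : Type*} [NormedAddCommGroup F] [InnerProductSpace ℝ F]
  [FiniteDimensional ℝ F] [MeasurableSpace F] [BorelSpace F]

theorem map_volume_eq_subspaceVolume {H : Submodule ℝ (Euc n)} (L : F ≃ₗᵢ[ℝ] H) :
    (volume : Measure F).map L = subspaceVolume H := by
  let _ : MeasureSpace H := measureSpaceOfInnerProductSpace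
  exact L.measurePreserving.map_eq.trans (stdOrthonormalBasis ℝ H).addHaar_eq_volume.symm

theorem sectionMeasure_range_eq_integral (f : Euc n → ℝ) (hK : MeasurableSet K)
    (V : F →ₗᵢ[ℝ] Euc n) :
    sectionMeasure f K (LinearMap.range V.toLinearMap) = ∫ y, K.indicator f (V y) := by
  have hmap : sectionMeasure f K (LinearMap.range V.toLinearMap) =
      ∫ y in V ⁻¹' K, f (V y) := by
    rw [sectionMeasure, ← map_volume_eq_subspaceVolume V.equivRange]
    exact V.equivRange.toHomeomorph.measurableEmbedding.setIntegral_map _ _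
  rw [hmap, ← integral_indicator (V.continuous.measurable hK)]
  rfl

end Sections

section PolarCoordinates

theorem setLIntegral_Ioc_ofReal_pow (j : ℕ) {a : ℝ} (ha : 0 ≤ a) :
    (j + 1 : ℕ) * ∫⁻ t in Ioc 0 a, ENNReal.ofReal (t ^ j) = ENNReal.ofReal a ^ (j + 1) := by
  have hnonneg : 0 ≤ᵐ[volume.restrict (Ioc 0 a)] fun t : ℝ => t ^ j :=
    (ae_restrict_mem measurableSet_Ioc).mono fun t ht => pow_nonneg ht.1.le j
  rw [← ofReal_integral_eq_lintegral_ofReal (intervalIntegral.intervalIntegrable_pow j).1 hnonneg,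
    ← intervalIntegral.integral_of_le ha, integral_pow, zero_pow j.succ_ne_zero, sub_zero,
    ← ENNReal.ofReal_natCast, ← ENNReal.ofReal_mul (Nat.cast_nonneg _), Nat.cast_succ,
    mul_div_cancel₀ _ (by positivity), ENNReal.ofReal_pow ha]

theorem ofReal_pow_mul_ofReal_inv_pow {t : ℝ} (ht : 0 < t) (j k : ℕ) :
    ENNReal.ofReal (t ^ (j + k)) * ENNReal.ofReal t⁻¹ ^ k = ENNReal.ofReal (t ^ j) := by
  rw [← ENNReal.ofReal_pow (by positivity), ← ENNReal.ofReal_mul (by positivity), pow_add,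
    mul_assoc, ← mul_pow, mul_inv_cancel₀ ht.ne', one_pow, mul_one]

variable {E : Type*} [NormedAddCommGroup E] [NormedSpace ℝ E] [FiniteDimensional ℝ E]
  [MeasurableSpace E] [BorelSpace E] [Nontrivial E] (μ : Measure E) [μ.IsAddHaarMeasure]

theorem lintegral_eq_lintegral_toSphere {g : E → ℝ≥0∞} (hg : Measurable g) :
    ∫⁻ x, g x ∂μ = ∫⁻ ξ : sphere (0 : E) 1, (∫⁻ t in Ioi (0 : ℝ),
      ENNReal.ofReal (t ^ (finrank ℝ E - 1)) * g (t • (ξ : E))) ∂μ.toSphere := by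
  have hG : Measurable fun p : sphere (0 : E) 1 × Ioi (0 : ℝ) => g ((p.2 : ℝ) • (p.1 : E)) :=
    hg.comp (Continuous.measurable (by fun_prop))
  calc ∫⁻ x, g x ∂μ = ∫⁻ x : ({0}ᶜ : Set E), g x ∂(μ.comap Subtype.val) := by
        rw [lintegral_subtype_comap (measurableSet_singleton _).compl g, restrict_compl_singleton]
    _ = ∫⁻ p, g ((p.2 : ℝ) • (p.1 : E))
          ∂(μ.toSphere.prod (Measure.volumeIoiPow (finrank ℝ E - 1))) := by
        rw [← μ.measurePreserving_homeomorphUnitSphereProd.lintegral_comp hG]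
        refine lintegral_congr fun x => congrArg g ?_
        exact congrArg Subtype.val ((homeomorphUnitSphereProd E).symm_apply_apply x).symm
    _ = ∫⁻ ξ, ∫⁻ t : Ioi (0 : ℝ), g ((t : ℝ) • (ξ : E))
          ∂(Measure.volumeIoiPow (finrank ℝ E - 1)) ∂μ.toSphere :=
        lintegral_prod _ hG.aemeasurable
    _ = _ := by
        refine lintegral_congr fun ξ => ?_
        have hray : Measurable fun t : Ioi (0 : ℝ) => g ((t : ℝ) • (ξ : E)) :=
          hG.comp measurable_prodMk_left
        rw [Measure.volumeIoiPow, lintegral_withDensity_eq_lintegral_mul _ (by fun_prop) hray]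
        exact lintegral_subtype_comap measurableSet_Ioi
          fun t : ℝ => ENNReal.ofReal (t ^ (finrank ℝ E - 1)) * g (t • (ξ : E))

theorem lintegral_comp_norm {a : ℝ → ℝ≥0∞} (ha : Measurable a) :
    ∫⁻ x, a ‖x‖ ∂μ = μ.toSphere univ *
      ∫⁻ t in Ioi (0 : ℝ), ENNReal.ofReal (t ^ (finrank ℝ E - 1)) * a t := by
  have hnorm : Measurable fun x : E => a ‖x‖ := ha.comp measurable_norm
  rw [lintegral_eq_lintegral_toSphere μ hnorm, mul_comm, ← lintegral_const]
  refine lintegral_congr fun ξ => setLIntegral_congr_fun measurableSet_Ioi fun t (ht : 0 < t) => ?_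
  simp only [norm_smul, norm_eq_of_mem_sphere, mul_one,
    Real.norm_of_nonneg ht.le]

theorem lintegral_inv_norm_pow_mul_comp_norm {F : Type*} [NormedAddCommGroup F] [NormedSpace ℝ F]
    [FiniteDimensional ℝ F] [MeasurableSpace F] [BorelSpace F] [Nontrivial F] (ν : Measure F)
    [ν.IsAddHaarMeasure] {k : ℕ} (hEF : finrank ℝ E = finrank ℝ F + k) {a : ℝ → ℝ≥0∞}
    (ha : Measurable a) :
    ν.toSphere univ * ∫⁻ x, ENNReal.ofReal ‖x‖⁻¹ ^ k * a ‖x‖ ∂μ =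
      μ.toSphere univ * ∫⁻ y, a ‖y‖ ∂ν := by
  have hb : Measurable fun t : ℝ => ENNReal.ofReal t⁻¹ ^ k * a t := by fun_prop
  rw [lintegral_comp_norm μ hb, lintegral_comp_norm ν ha, mul_left_comm]
  congr 2
  refine setLIntegral_congr_fun measurableSet_Ioi fun t (ht : 0 < t) => ?_
  have hdim : finrank ℝ E - 1 = (finrank ℝ F - 1) + k := by
    have := Module.finrank_pos (R := ℝ) (M := F)
    omega
  rw [← mul_assoc, hdim, ofReal_pow_mul_ofReal_inv_pow ht]

end PolarCoordinates

section RadialIntegrals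

variable {n k : ℕ} {D : Set (Euc n)}

theorem IsStarBody.setLIntegral_eq_lintegral_toSphere (hD : IsStarBody D) (hk : k < n)
    {w : Euc n → ℝ≥0∞} (hw : Measurable w)
    (hom : ∀ t : ℝ, 0 < t → ∀ x, w (t • x) = ENNReal.ofReal t⁻¹ ^ k * w x) :
    (n - k : ℕ) * ∫⁻ x in D, w x =
      ∫⁻ ξ : sphere (0 : Euc n) 1, w ξ * ENNReal.ofReal (radialFunction D ξ) ^ (n - k)
        ∂(volume : Measure (Euc n)).toSphere := by
  have : Nonempty (Fin n) := ⟨⟨0, by omega⟩⟩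
  obtain ⟨j, hj⟩ : ∃ j, n - k = j + 1 := ⟨n - k - 1, by omega⟩
  rw [← lintegral_indicator hD.isClosed.measurableSet, lintegral_eq_lintegral_toSphere _
    (hw.indicator hD.isClosed.measurableSet), finrank_euclideanSpace_fin, hj,
    ← lintegral_const_mul' _ _ (ENNReal.natCast_ne_top _)]
  refine lintegral_congr fun ξ => ?_
  have hξ : (ξ : Euc n) ≠ 0 := ne_zero_of_mem_unit_sphere ξ
  have hray : ∀ t ∈ Ioi (0 : ℝ), ENNReal.ofReal (t ^ (n - 1)) * D.indicator w (t • (ξ : Euc n)) =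
      (Iic (radialFunction D ξ)).indicator (fun t => ENNReal.ofReal (t ^ j) * w ξ) t := by
    intro t (ht : 0 < t)
    simp only [indicator, hD.smul_mem_iff hξ ht.le, mem_Iic, hom t ht]
    split_ifs
    · rw [← mul_assoc, show n - 1 = j + k by omega, ofReal_pow_mul_ofReal_inv_pow ht]
    · exact mul_zero _
  rw [setLIntegral_congr_fun measurableSet_Ioi hray, setLIntegral_indicator measurableSet_Iic,
    inter_comm, Ioi_inter_Iic, lintegral_mul_const _ (by fun_prop), ← mul_assoc,
    setLIntegral_Ioc_ofReal_pow j (hD.radialFunction_pos hξ).le, mul_comm]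

theorem IsStarBody.natCast_mul_volume (hD : IsStarBody D) (hn : 0 < n) :
    n * volume D = ∫⁻ ξ : sphere (0 : Euc n) 1, ENNReal.ofReal (radialFunction D ξ) ^ n
      ∂(volume : Measure (Euc n)).toSphere := by
  simpa only [tsub_zero, Pi.one_apply, setLIntegral_one, one_mul] using
    hD.setLIntegral_eq_lintegral_toSphere hn measurable_one (fun t _ x => by simp)

theorem IsStarBody.setLIntegral_closedBall_radialFunction_pow (hD : IsStarBody D) (hk : k < n) :
    (n - k : ℕ) * ∫⁻ x in closedBall (0 : Euc n) 1, ENNReal.ofReal (radialFunction D x) ^ k =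
      ∫⁻ ξ : sphere (0 : Euc n) 1, ENNReal.ofReal (radialFunction D ξ) ^ k
        ∂(volume : Measure (Euc n)).toSphere := by
  have hw : Measurable fun x => ENNReal.ofReal (radialFunction D x) ^ k :=
    hD.measurable_radialFunction.ennreal_ofReal.pow_const k
  rw [(isSymmStarBody_closedBall one_pos).1.setLIntegral_eq_lintegral_toSphere hk hw
    fun t ht x => ?_]
  · refine lintegral_congr fun ξ => ?_
    rw [radialFunction_closedBall one_pos ξ.2, ENNReal.ofReal_one, one_pow, mul_one]
  · rw [radialFunction_smul ht, ENNReal.ofReal_mul (by positivity), mul_pow]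

theorem IsStarBody.natCast_mul_setLIntegral_closedBall_radialFunction_pow_le (hD : IsStarBody D)
    (hk1 : 1 ≤ k) (hk : k < n) :
    (n - k : ℕ) * ∫⁻ x in closedBall (0 : Euc n) 1, ENNReal.ofReal (radialFunction D x) ^ k ≤
      (n * volume (closedBall (0 : Euc n) 1)) ^ (((n : ℝ) - k) / n) *
        (n * volume D) ^ ((k : ℝ) / n) := by
  have hk0 : (0 : ℝ) < k := by exact_mod_cast hk1
  have hkn : (k : ℝ) < n := by exact_mod_cast hk
  have : Nonempty (Fin n) := ⟨⟨0, by omega⟩⟩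
  have hpq : ((n : ℝ) / k).HolderConjugate (n / (n - k)) := by
    rw [Real.holderConjugate_iff]
    refine ⟨(one_lt_div hk0).2 hkn, ?_⟩
    rw [inv_div, inv_div, ← add_div, add_sub_cancel, div_self (hk0.trans hkn).ne']
  have hholder := ENNReal.lintegral_mul_le_Lp_mul_Lq (volume : Measure (Euc n)).toSphere hpq
    (f := fun ξ : sphere (0 : Euc n) 1 => ENNReal.ofReal (radialFunction D ξ) ^ k) (g := 1)
    ((hD.measurable_radialFunction.ennreal_ofReal.pow_const k).comp
      measurable_subtype_coe).aemeasurable aemeasurable_one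
  have hpow (a : ℝ≥0∞) : (a ^ k) ^ ((n : ℝ) / k) = a ^ n := by
    rw [← ENNReal.rpow_natCast, ← ENNReal.rpow_mul, mul_div_cancel₀ _ hk0.ne', ENNReal.rpow_natCast]
  simp only [Pi.mul_apply, Pi.one_apply, mul_one, ENNReal.one_rpow, lintegral_one, one_div_div,
    Measure.toSphere_apply_univ, finrank_euclideanSpace_fin, hpow] at hholder
  rw [hD.setLIntegral_closedBall_radialFunction_pow hk, hD.natCast_mul_volume (by omega),
    Measure.addHaar_closedBall_eq_addHaar_ball, mul_comm]
  exact hholder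

end RadialIntegrals

section OrthogonalGroup

theorem exists_isProbabilityMeasure_isMulRightInvariant (G : Type*) [Group G] [TopologicalSpace G]
    [IsTopologicalGroup G] [CompactSpace G] [MeasurableSpace G] [BorelSpace G] :
    ∃ ν : Measure G, IsProbabilityMeasure ν ∧ ν.IsMulRightInvariant := by
  set ν : Measure G := Measure.haarMeasure ⊤
  have hν : IsProbabilityMeasure ν :=
    ⟨Measure.haarMeasure_self (K₀ := (⊤ : TopologicalSpace.PositiveCompacts G))⟩
  exact ⟨ν.inv, Measure.isProbabilityMeasure_map measurable_inv.aemeasurable, inferInstance⟩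

variable {E : Type*} [NormedAddCommGroup E] [InnerProductSpace ℝ E] [FiniteDimensional ℝ E]

variable (E) in
/-- The orthogonal group of a Euclidean space, realised inside the algebra of its endomorphisms,
from which it inherits its topology. -/
abbrev OrthogonalGroup : Type _ := unitary (E →L[ℝ] E)

namespace OrthogonalGroup

instance : CompactSpace (OrthogonalGroup E) := by
  refine isCompact_iff_compactSpace.1 (isCompact_of_isClosed_isBounded isClosed_unitary
    (isBounded_iff_forall_norm_le.2 ⟨1, fun U hU => ?_⟩))
  refine ContinuousLinearMap.opNorm_le_bound _ zero_le_one fun x => ?_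
  rw [one_mul]
  exact ((Unitary.linearIsometryEquiv ⟨U, hU⟩).norm_map x).le

theorem exists_forall_apply_eq (e : E ≃ₗᵢ[ℝ] E) : ∃ U : OrthogonalGroup E, ∀ x, U.1 x = e x :=
  ⟨Unitary.linearIsometryEquiv.symm e, fun _ => rfl⟩

variable (ν : Measure (OrthogonalGroup E))

theorem lintegral_apply_eq_of_norm_eq [ν.IsMulRightInvariant] (G : E → ℝ≥0∞) {x y : E}
    (h : ‖x‖ = ‖y‖) : ∫⁻ U, G (U.1 x) ∂ν = ∫⁻ U, G (U.1 y) ∂ν := by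
  obtain ⟨e, rfl⟩ := exists_linearIsometryEquiv_apply_eq h
  obtain ⟨W, hW⟩ := exists_forall_apply_eq e
  rw [← hW, ← lintegral_mul_right_eq_self (fun U : OrthogonalGroup E => G (U.1 x)) W]
  rfl

variable [MeasurableSpace E] [BorelSpace E]

theorem measurable_comp_apply {F : Type*} [TopologicalSpace F] [SecondCountableTopology F]
    [MeasurableSpace F] [BorelSpace F] {G : E → ℝ≥0∞} (hG : Measurable G) {ι : F → E}
    (hι : Continuous ι) : Measurable fun p : OrthogonalGroup E × F => G (p.1.1 (ι p.2)) := by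
  have hcont : Continuous fun p : OrthogonalGroup E × F => p.1.1 (ι p.2) := by fun_prop
  exact hG.comp hcont.measurable

variable [IsProbabilityMeasure ν]

theorem lintegral_comp_norm_mul {w : ℝ → ℝ≥0∞} (hw : Measurable w) {G : E → ℝ≥0∞}
    (hG : Measurable G) :
    ∫⁻ y, w ‖y‖ * G y = ∫⁻ y, w ‖y‖ * ∫⁻ U, G (U.1 y) ∂ν := by
  have hrot (U : OrthogonalGroup E) : ∫⁻ y, w ‖y‖ * G y = ∫⁻ y, w ‖y‖ * G (U.1 y) := by
    set e := Unitary.linearIsometryEquiv U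
    rw [← e.measurePreserving.lintegral_comp (f := fun y => w ‖y‖ * G y) (by fun_prop)]
    simp only [e.norm_map]
    rfl
  have hmeas : Measurable fun p : OrthogonalGroup E × E => w ‖p.2‖ * G (p.1.1 p.2) :=
    (hw.comp measurable_snd.norm).mul (measurable_comp_apply hG continuous_id)
  calc ∫⁻ y, w ‖y‖ * G y = ∫⁻ _, ∫⁻ y, w ‖y‖ * G y ∂volume ∂ν := by
        rw [lintegral_const, measure_univ, mul_one]
    _ = ∫⁻ U, ∫⁻ y, w ‖y‖ * G (U.1 y) ∂volume ∂ν := lintegral_congr hrot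
    _ = ∫⁻ y, ∫⁻ U, w ‖y‖ * G (U.1 y) ∂ν := lintegral_lintegral_swap hmeas.aemeasurable
    _ = _ := lintegral_congr fun y => lintegral_const_mul _
        ((measurable_comp_apply hG continuous_id).comp measurable_prodMk_right)

variable {F : Type*} [NormedAddCommGroup F] [InnerProductSpace ℝ F] [FiniteDimensional ℝ F]
  [MeasurableSpace F] [BorelSpace F] [Nontrivial F]

theorem exists_lintegral_inv_norm_pow_mul_eq [ν.IsMulRightInvariant] {k : ℕ}
    (hEF : finrank ℝ E = finrank ℝ F + k) (ι : F →ₗᵢ[ℝ] E) :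
    ∃ c : ℝ≥0∞, ∀ G : E → ℝ≥0∞, Measurable G →
      ∫⁻ y, ENNReal.ofReal ‖y‖⁻¹ ^ k * G y = c * ∫⁻ U, ∫⁻ h, G (U.1 (ι h)) ∂volume ∂ν := by
  have : Nontrivial E := ι.injective.nontrivial
  obtain ⟨u, hu⟩ : ∃ u : F, ‖u‖ = 1 := exists_norm_eq F zero_le_one
  set σE := (volume : Measure E).toSphere univ
  set σF := (volume : Measure F).toSphere univ
  have hσF : σF ≠ 0 := Measure.measure_univ_ne_zero.2 (Measure.toSphere_ne_zero _)
  refine ⟨σE / σF, fun G hG => ?_⟩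
  set a : ℝ → ℝ≥0∞ := fun t => ∫⁻ U, G (U.1 (ι (t • u))) ∂ν
  have ha : Measurable a := (measurable_comp_apply hG
    (by fun_prop : Continuous fun t : ℝ => ι (t • u))).lintegral_prod_left'
  have hnorm (y : E) : ∫⁻ U, G (U.1 y) ∂ν = a ‖y‖ := by
    refine lintegral_apply_eq_of_norm_eq ν G ?_
    rw [ι.norm_map, norm_smul, hu, mul_one, norm_norm]
  have haverage : ∫⁻ U, ∫⁻ h, G (U.1 (ι h)) ∂volume ∂ν = ∫⁻ h : F, a ‖h‖ := by
    rw [lintegral_lintegral_swap (measurable_comp_apply hG ι.continuous).aemeasurable]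
    simp only [hnorm, ι.norm_map]
  rw [lintegral_comp_norm_mul ν (by fun_prop : Measurable fun t : ℝ => ENNReal.ofReal t⁻¹ ^ k) hG,
    haverage]
  simp only [hnorm]
  rw [← ENNReal.mul_div_right_comm, ENNReal.eq_div_iff hσF (measure_ne_top _ _)]
  exact lintegral_inv_norm_pow_mul_comp_norm volume volume hEF ha

end OrthogonalGroup

end OrthogonalGroup

section SectionBound

theorem setLIntegral_eq_lintegral_mul_indicator_one {α : Type*} [MeasurableSpace α]
    (μ : Measure α) (w : α → ℝ≥0∞) {s : Set α} (hs : MeasurableSet s) :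
    ∫⁻ x in s, w x ∂μ = ∫⁻ x, w x * s.indicator 1 x ∂μ := by
  simp only [← lintegral_indicator hs, ← indicator_mul_right, Pi.one_apply, mul_one]

variable {E F : Type*} [NormedAddCommGroup E] [InnerProductSpace ℝ E]
  [NormedAddCommGroup F] [InnerProductSpace ℝ F] [FiniteDimensional ℝ F]
  [MeasurableSpace F] [BorelSpace F]

theorem volume_closedBall_mul_lintegral_comp_le {G : E → ℝ≥0∞} {M : ℝ≥0∞}
    (hM : ∀ V : F →ₗᵢ[ℝ] E, ∫⁻ y, G (V y) ≤ M) {A : F →ₗ[ℝ] E} (hA : Function.Injective A) :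
    volume (closedBall (0 : F) 1) * ∫⁻ y, G (A y) ≤
      M * ∫⁻ y, (closedBall (0 : E) 1).indicator 1 (A y) := by
  obtain ⟨V, B, hVB⟩ := exists_linearIsometry_comp_linearEquiv_eq hA
  have hball : ∫⁻ y, (closedBall (0 : E) 1).indicator (1 : E → ℝ≥0∞) (V y) =
      volume (closedBall (0 : F) 1) := by
    rw [← lintegral_indicator_one measurableSet_closedBall]
    simp only [indicator, mem_closedBall_zero_iff, V.norm_map, Pi.one_apply]
  simp only [hVB]
  rw [lintegral_comp_linearEquiv volume B fun y => G (V y),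
    lintegral_comp_linearEquiv volume B fun y => (closedBall (0 : E) 1).indicator 1 (V y),
    hball, mul_left_comm, mul_left_comm M, mul_comm M]
  gcongr
  exact hM V

variable [FiniteDimensional ℝ E] [MeasurableSpace E] [BorelSpace E]

variable (F) in
/-- A weight `w` on `E` has the section bound relative to `F` if a function all of whose integrals
over isometric copies of `F` in `E` are at most `M` has `w`-integral at most `M` times the `w`-mass
of the unit ball of `E`, divided by the volume of the unit ball of `F`. The volume is kept on the
left so that no division in `ℝ≥0∞` occurs. -/
def HasSectionBound (w : E → ℝ≥0∞) : Prop :=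
  ∀ ⦃G : E → ℝ≥0∞⦄, Measurable G → ∀ M : ℝ≥0∞, (∀ V : F →ₗᵢ[ℝ] E, ∫⁻ y, G (V y) ≤ M) →
    volume (closedBall (0 : F) 1) * ∫⁻ x, w x * G x ≤ M * ∫⁻ x in closedBall (0 : E) 1, w x

namespace HasSectionBound

theorem inv_norm_comp_linearEquiv_pow [Nontrivial F] {k : ℕ}
    (hEF : finrank ℝ E = finrank ℝ F + k) (T : E ≃ₗ[ℝ] E) :
    HasSectionBound F fun x => ENNReal.ofReal ‖T x‖⁻¹ ^ k := by
  intro G hG M hM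
  obtain ⟨ν, _, _⟩ := exists_isProbabilityMeasure_isMulRightInvariant (OrthogonalGroup E)
  obtain ⟨ι⟩ : Nonempty (F →ₗᵢ[ℝ] E) := nonempty_linearIsometry_of_finrank_le (by omega)
  obtain ⟨c, hc⟩ := OrthogonalGroup.exists_lintegral_inv_norm_pow_mul_eq ν hEF ι
  have hTsymm : Measurable T.symm := T.symm.toContinuousLinearEquiv.continuous.measurable
  obtain ⟨d, hd⟩ : ∃ d : ℝ≥0∞, ∀ H : E → ℝ≥0∞, Measurable H →
      ∫⁻ x, ENNReal.ofReal ‖T x‖⁻¹ ^ k * H x =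
        d * ∫⁻ U, ∫⁻ h, H (T.symm (U.1 (ι h))) ∂volume ∂ν := by
    refine ⟨ENNReal.ofReal |(LinearMap.det (T : E →ₗ[ℝ] E))⁻¹| * c, fun H hH => ?_⟩
    have hHT := lintegral_comp_linearEquiv volume T
      fun y => ENNReal.ofReal ‖y‖⁻¹ ^ k * H (T.symm y)
    rw [hc (fun y => H (T.symm y)) (hH.comp hTsymm), ← mul_assoc] at hHT
    simpa only [T.symm_apply_apply] using hHT
  have hB : Measurable ((closedBall (0 : E) 1).indicator (1 : E → ℝ≥0∞)) :=
    measurable_one.indicator measurableSet_closedBall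
  have hcopy (U : OrthogonalGroup E) := volume_closedBall_mul_lintegral_comp_le hM
    (A := T.symm.toLinearMap ∘ₗ (Unitary.linearIsometryEquiv U).toLinearMap ∘ₗ ι.toLinearMap)
    (T.symm.injective.comp ((Unitary.linearIsometryEquiv U).injective.comp ι.injective))
  rw [setLIntegral_eq_lintegral_mul_indicator_one _ _ measurableSet_closedBall, hd G hG, hd _ hB,
    mul_left_comm, mul_left_comm M]
  gcongr d * ?_
  calc _ ≤ ∫⁻ U, volume (closedBall (0 : F) 1) * ∫⁻ h, G (T.symm (U.1 (ι h))) ∂volume ∂ν :=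
        lintegral_const_mul_le _ _
    _ ≤ ∫⁻ U, M * ∫⁻ h, (closedBall (0 : E) 1).indicator 1 (T.symm (U.1 (ι h))) ∂volume ∂ν :=
        lintegral_mono hcopy
    _ = _ := lintegral_const_mul _ (OrthogonalGroup.measurable_comp_apply (hB.comp hTsymm)
        ι.continuous).lintegral_prod_right'

theorem finset_sum {ι : Type*} {s : Finset ι} {w : ι → E → ℝ≥0∞}
    (hw : ∀ i ∈ s, HasSectionBound F (w i)) (hwm : ∀ i ∈ s, Measurable (w i)) :
    HasSectionBound F fun x => ∑ i ∈ s, w i x := by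
  intro G hG M hM
  have hwG : ∀ i ∈ s, Measurable fun x => w i x * G x := fun i hi => (hwm i hi).mul hG
  simp only [Finset.sum_mul]
  rw [lintegral_finsetSum s hwG, lintegral_finsetSum s hwm, Finset.mul_sum, Finset.mul_sum]
  exact Finset.sum_le_sum fun i hi => hw i hi hG M hM

theorem of_forall_exists_le_mul {w : E → ℝ≥0∞}
    (h : ∀ c : ℝ, 1 < c → ∃ v : E → ℝ≥0∞, HasSectionBound F v ∧
      ∀ x, w x ≤ ENNReal.ofReal c * v x ∧ v x ≤ ENNReal.ofReal c * w x) :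
    HasSectionBound F w := by
  intro G hG M hM
  set I := ∫⁻ x in closedBall (0 : E) 1, w x
  have hle : ∀ c ∈ Ioi (1 : ℝ), volume (closedBall (0 : F) 1) * ∫⁻ x, w x * G x ≤
      ENNReal.ofReal c * (ENNReal.ofReal c * (M * I)) := by
    intro c hc
    obtain ⟨v, hv, hwv⟩ := h c hc
    calc volume (closedBall (0 : F) 1) * ∫⁻ x, w x * G x
        ≤ volume (closedBall (0 : F) 1) * ∫⁻ x, ENNReal.ofReal c * v x * G x := by
          gcongr with x
          exact (hwv x).1
      _ = ENNReal.ofReal c * (volume (closedBall (0 : F) 1) * ∫⁻ x, v x * G x) := by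
          simp only [mul_assoc]
          rw [lintegral_const_mul' _ _ ENNReal.ofReal_ne_top, mul_left_comm]
      _ ≤ ENNReal.ofReal c * (M * ∫⁻ x in closedBall (0 : E) 1, v x) := by
          gcongr ENNReal.ofReal c * ?_
          exact hv hG M hM
      _ ≤ ENNReal.ofReal c * (M * ∫⁻ x in closedBall (0 : E) 1, ENNReal.ofReal c * w x) := by
          gcongr with x
          exact (hwv x).2
      _ = ENNReal.ofReal c * (ENNReal.ofReal c * (M * I)) := by
          rw [lintegral_const_mul' _ _ ENNReal.ofReal_ne_top, mul_left_comm M]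
  have hlim : Tendsto (fun c : ℝ => ENNReal.ofReal c * (ENNReal.ofReal c * (M * I))) (𝓝[>] 1)
      (𝓝 (M * I)) := by
    have hofReal : Tendsto ENNReal.ofReal (𝓝[>] 1) (𝓝 1) := by
      simpa only [ENNReal.ofReal_one] using
        (ENNReal.continuous_ofReal.tendsto 1).mono_left nhdsWithin_le_nhds
    simpa only [one_mul] using ENNReal.Tendsto.mul hofReal (Or.inl one_ne_zero)
      (ENNReal.Tendsto.mul hofReal (Or.inl one_ne_zero) (tendsto_const_nhds (x := M * I))
        (Or.inr ENNReal.one_ne_top)) (Or.inr ENNReal.one_ne_top)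
  exact ge_of_tendsto hlim (eventually_of_mem self_mem_nhdsWithin hle)

end HasSectionBound

section Euclidean

variable {n k : ℕ} [Nontrivial F]

theorem IsSymmEllipsoid.hasSectionBound (hF : n = finrank ℝ F + k) {D : Set (Euc n)}
    (hD : IsSymmEllipsoid D) :
    HasSectionBound F fun x => ENNReal.ofReal (radialFunction D x) ^ k := by
  obtain ⟨T, rfl⟩ := hD
  simp only [radialFunction_image_closedBall]
  exact HasSectionBound.inv_norm_comp_linearEquiv_pow (by rwa [finrank_euclideanSpace_fin]) T.symm

theorem IsRadialSum.hasSectionBound (hk : k ≠ 0) (hF : n = finrank ℝ F + k) {m : ℕ}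
    {E : Fin m → Set (Euc n)} (hE : ∀ i, IsSymmEllipsoid (E i)) {L : Set (Euc n)}
    (hL : IsRadialSum k E L) :
    HasSectionBound F fun x => ENNReal.ofReal (radialFunction L x) ^ k := by
  have hsum (x : Euc n) : ENNReal.ofReal (radialFunction L x) ^ k =
      ∑ i, ENNReal.ofReal (radialFunction (E i) x) ^ k := by
    simp only [← ENNReal.ofReal_pow (radialFunction_nonneg _ x)]
    rw [hL.radialFunction_pow hk,
      ENNReal.ofReal_sum_of_nonneg fun i _ => pow_nonneg (radialFunction_nonneg _ x) k]
  simp only [hsum]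
  exact HasSectionBound.finset_sum (fun i _ => (hE i).hasSectionBound hF)
    fun i _ => (hE i).measurable_radialFunction.ennreal_ofReal.pow_const k

theorem IsGenIntersectionBody.hasSectionBound (hk : k ≠ 0) (hF : n = finrank ℝ F + k)
    {D : Set (Euc n)} (hD : IsGenIntersectionBody k D) :
    HasSectionBound F fun x => ENNReal.ofReal (radialFunction D x) ^ k := by
  refine HasSectionBound.of_forall_exists_le_mul fun c hc => ?_
  have hc0 : 0 ≤ c := zero_le_one.trans hc.le
  set b : ℝ := c ^ (k : ℝ)⁻¹
  have hb0 : 0 ≤ b := Real.rpow_nonneg hc0 _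
  have hbk : ENNReal.ofReal c = ENNReal.ofReal b ^ k := by
    rw [← ENNReal.ofReal_pow hb0, Real.rpow_inv_natCast_pow hc0 hk]
  obtain ⟨ε, hε, hnear⟩ := hD.1.1.exists_radialDist_lt_imp_le_mul
    (Real.one_lt_rpow hc (by positivity) : 1 < b)
  obtain ⟨m, E, L, -, hE, hL, hdist⟩ := hD.2 ε hε
  refine ⟨_, hL.hasSectionBound hk hF hE, fun x => ?_⟩
  simp only [hbk, ← mul_pow, ← ENNReal.ofReal_mul hb0]
  obtain ⟨hDL, hLD⟩ := hnear L hL.1 hdist x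
  exact ⟨by gcongr, by gcongr⟩

end Euclidean

end SectionBound

section DominatedSections

theorem measurable_indicator_of_continuousOn {X : Type*} [TopologicalSpace X] [MeasurableSpace X]
    [OpensMeasurableSpace X] {K : Set X} {f : X → ℝ} (hf : ContinuousOn f K)
    (hK : MeasurableSet K) : Measurable (K.indicator f) := by
  classical
  rw [← piecewise_eq_indicator]
  exact hf.measurable_piecewise continuousOn_const hK

variable {E F : Type*} [NormedAddCommGroup E] [NormedSpace ℝ E] [NormedAddCommGroup F]
  [NormedSpace ℝ F] [FiniteDimensional ℝ F] [MeasurableSpace F] [BorelSpace F]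
  (μ : Measure F) [IsFiniteMeasureOnCompacts μ] {K : Set E} {f : E → ℝ}

theorem exists_integrable_norm_indicator_comp_le (hK : IsCompact K) (hf : ContinuousOn f K) :
    ∃ g : F → ℝ, Integrable g μ ∧ ∀ (V : F →ₗᵢ[ℝ] E) (y : F), ‖K.indicator f (V y)‖ ≤ g y := by
  obtain ⟨C, hC⟩ := hK.exists_bound_of_continuousOn hf
  obtain ⟨R, hR⟩ := hK.isBounded.exists_norm_le
  have : ProperSpace F := FiniteDimensional.proper ℝ F
  refine ⟨(closedBall 0 R).indicator fun _ => |C|,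
    (integrable_indicator_iff measurableSet_closedBall).2
      (integrableOn_const (μ := μ) measure_closedBall_lt_top.ne), fun V y => ?_⟩
  by_cases hy : V y ∈ K
  · have hyR : y ∈ closedBall 0 R := by
      rw [mem_closedBall_zero_iff, ← V.norm_map]
      exact hR _ hy
    rw [indicator_of_mem hy, indicator_of_mem hyR]
    exact (hC _ hy).trans (le_abs_self C)
  · rw [indicator_of_notMem hy, norm_zero]
    exact indicator_nonneg (fun _ _ => abs_nonneg C) y

theorem integrable_indicator_comp [MeasurableSpace E] [BorelSpace E] (hK : IsCompact K)
    (hf : ContinuousOn f K) (V : F →ₗᵢ[ℝ] E) : Integrable (fun y => K.indicator f (V y)) μ := by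
  obtain ⟨g, hg, hle⟩ := exists_integrable_norm_indicator_comp_le μ hK hf
  exact hg.mono' ((measurable_indicator_of_continuousOn hf hK.measurableSet).comp
    V.continuous.measurable).aestronglyMeasurable (ae_of_all _ (hle V))

end DominatedSections

section Attainment

variable {n : ℕ} {K : Set (Euc n)} {f : Euc n → ℝ}

namespace IsStarBody

theorem continuous_integral_indicator_apply {F : Type*} [NormedAddCommGroup F]
    [InnerProductSpace ℝ F] [FiniteDimensional ℝ F] [MeasurableSpace F] [BorelSpace F]
    (hK : IsStarBody K) (hf : ContinuousOn f K) (ι : F →ₗᵢ[ℝ] Euc n) :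
    Continuous fun U : OrthogonalGroup (Euc n) => ∫ y, K.indicator f (U.1 (ι y)) := by
  obtain ⟨g, hg, hle⟩ := exists_integrable_norm_indicator_comp_le (F := F) volume hK.isCompact hf
  let V (U : OrthogonalGroup (Euc n)) : F →ₗᵢ[ℝ] Euc n :=
    (Unitary.linearIsometryEquiv U).toLinearIsometry.comp ι
  refine continuous_iff_continuousAt.2 fun U => continuousAt_of_dominated
    (.of_forall fun W =>
      (integrable_indicator_comp volume hK.isCompact hf (V W)).aestronglyMeasurable)
    (.of_forall fun W => ae_of_all _ (hle (V W))) hg ?_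
  filter_upwards [hK.ae_notMem_frontier_comp volume (A := (V U).toLinearMap) (V U).injective]
    with y hy
  exact ContinuousAt.comp (f := fun W : OrthogonalGroup (Euc n) => W.1 (ι y))
    ((hf.mono interior_subset).continuousAt_indicator hy) (by fun_prop)

theorem exists_isGreatest_sectionMeasure (hK : IsStarBody K) (hf : ContinuousOn f K) {m : ℕ}
    (hm : m ≤ n) :
    ∃ M : ℝ, IsGreatest
      {s : ℝ | ∃ H : Submodule ℝ (Euc n), finrank ℝ H = m ∧ s = sectionMeasure f K H} M := by
  obtain ⟨ι⟩ : Nonempty (Euc m →ₗᵢ[ℝ] Euc n) :=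
    nonempty_linearIsometry_of_finrank_le (by simpa only [finrank_euclideanSpace_fin])
  obtain ⟨U, -, hU⟩ := isCompact_univ.exists_isMaxOn univ_nonempty
    (hK.continuous_integral_indicator_apply hf ι).continuousOn
  set V : Euc m →ₗᵢ[ℝ] Euc n := (Unitary.linearIsometryEquiv U).toLinearIsometry.comp ι
  refine ⟨∫ y, K.indicator f (V y), ⟨LinearMap.range V.toLinearMap, ?_, ?_⟩, ?_⟩
  · rw [LinearMap.finrank_range_of_inj V.injective, finrank_euclideanSpace_fin]
  · exact (sectionMeasure_range_eq_integral f hK.isClosed.measurableSet V).symm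
  · rintro s ⟨H, hH, rfl⟩
    obtain ⟨W, rfl⟩ := exists_range_linearIsometry_eq (F := Euc m) H
      (by rw [hH, finrank_euclideanSpace_fin])
    obtain ⟨e, he⟩ := exists_linearIsometryEquiv_comp_eq W ι
    obtain ⟨T, hT⟩ := OrthogonalGroup.exists_forall_apply_eq e
    rw [sectionMeasure_range_eq_integral f hK.isClosed.measurableSet]
    calc ∫ y, K.indicator f (W y) = ∫ y, K.indicator f (T.1 (ι y)) := by simp only [hT, he]
      _ ≤ ∫ y, K.indicator f (V y) := hU (mem_univ T)

end IsStarBody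

end Attainment

section VolumeEstimate

variable {n k : ℕ} {K D : Set (Euc n)} {f : Euc n → ℝ}

theorem vol_nonneg (K : Set (Euc n)) : 0 ≤ vol K :=
  ENNReal.toReal_nonneg

theorem IsStarBody.vol_pos (hK : IsStarBody K) : 0 < vol K :=
  ENNReal.toReal_pos
    (Measure.measure_pos_of_mem_nhds _ (mem_interior_iff_mem_nhds.1 hK.zero_mem_interior)).ne'
    hK.isBounded.measure_lt_top.ne

theorem IsStarBody.setLIntegral_le_lintegral_radialFunction_pow_mul (hD : IsStarBody D)
    (hn : n ≠ 0) (k : ℕ) (G : Euc n → ℝ≥0∞) :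
    ∫⁻ x in D, G x ≤ ∫⁻ x, ENNReal.ofReal (radialFunction D x) ^ k * G x := by
  have : Nonempty (Fin n) := ⟨⟨0, Nat.pos_of_ne_zero hn⟩⟩
  rw [← lintegral_indicator hD.isClosed.measurableSet]
  refine lintegral_mono_ae ?_
  filter_upwards [Measure.ae_ne volume (0 : Euc n)] with x hx
  refine indicator_apply_le' (fun hxD => ?_) (fun _ => zero_le)
  exact le_mul_of_one_le_left zero_le
    (one_le_pow₀ (ENNReal.one_le_ofReal.2 (hD.one_le_radialFunction hx hxD)))

theorem IsGenIntersectionBody.volume_closedBall_mul_setLIntegral_le (hk1 : 1 ≤ k) (hk : k < n)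
    (hD : IsGenIntersectionBody k D) {G : Euc n → ℝ≥0∞} (hG : Measurable G) {M : ℝ≥0∞}
    (hM : ∀ V : Euc (n - k) →ₗᵢ[ℝ] Euc n, ∫⁻ y, G (V y) ≤ M) :
    (n - k : ℕ) * (volume (closedBall (0 : Euc (n - k)) 1) * ∫⁻ x in D, G x) ≤
      M * ((n * volume (closedBall (0 : Euc n) 1)) ^ (((n : ℝ) - k) / n) *
        (n * volume D) ^ ((k : ℝ) / n)) := by
  have : Nonempty (Fin (n - k)) := ⟨⟨0, by omega⟩⟩
  have hF : n = finrank ℝ (Euc (n - k)) + k := by rw [finrank_euclideanSpace_fin]; omega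
  calc _ ≤ (n - k : ℕ) * (volume (closedBall (0 : Euc (n - k)) 1) *
        ∫⁻ x, ENNReal.ofReal (radialFunction D x) ^ k * G x) := by
        gcongr _ * (_ * ?_)
        exact hD.1.1.setLIntegral_le_lintegral_radialFunction_pow_mul (by omega) k G
    _ ≤ (n - k : ℕ) * (M *
        ∫⁻ x in closedBall (0 : Euc n) 1, ENNReal.ofReal (radialFunction D x) ^ k) := by
        gcongr _ * ?_
        exact hD.hasSectionBound (by omega) hF hG M hM
    _ ≤ _ := by
        rw [mul_left_comm]
        gcongr M * ?_
        exact hD.1.1.natCast_mul_setLIntegral_closedBall_radialFunction_pow_le hk1 hk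

theorem mul_rpow_sub_div_mul_mul_rpow_div {a b c : ℝ} (ha : 0 ≤ a) (hb : 0 ≤ b) (hc : 0 < c)
    (s : ℝ) :
    (c * a) ^ ((c - s) / c) * (c * b) ^ (s / c) = c * (a ^ ((c - s) / c) * b ^ (s / c)) := by
  have hcc : c ^ ((c - s) / c) * c ^ (s / c) = c := by
    rw [← Real.rpow_add hc, ← add_div, sub_add_cancel, div_self hc.ne', Real.rpow_one]
  rw [Real.mul_rpow hc.le ha, Real.mul_rpow hc.le hb, mul_mul_mul_comm, hcc]

theorem ofReal_densityMeasure_le_setLIntegral (hKD : K ⊆ D) (hK : IsCompact K)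
    (hf : ContinuousOn f K) (hf0 : ∀ x ∈ K, 0 ≤ f x) :
    ENNReal.ofReal (densityMeasure f K) ≤ ∫⁻ x in D, ENNReal.ofReal (K.indicator f x) :=
  calc ENNReal.ofReal (densityMeasure f K) = ∫⁻ x in K, ENNReal.ofReal (f x) :=
        ofReal_integral_eq_lintegral_ofReal (hf.integrableOn_compact hK)
          (ae_restrict_of_forall_mem hK.measurableSet hf0)
    _ = ∫⁻ x in K, ENNReal.ofReal (K.indicator f x) :=
        setLIntegral_congr_fun hK.measurableSet fun x hx => by rw [indicator_of_mem hx]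
    _ ≤ ∫⁻ x in D, ENNReal.ofReal (K.indicator f x) := lintegral_mono_set hKD

theorem IsGenIntersectionBody.densityMeasure_le (hk1 : 1 ≤ k) (hk : k < n)
    (hD : IsGenIntersectionBody k D) (hKD : K ⊆ D) (hK : IsCompact K) (hf : ContinuousOn f K)
    (hf0 : ∀ x ∈ K, 0 ≤ f x) {M : ℝ} (hM0 : 0 ≤ M)
    (hM : ∀ V : Euc (n - k) →ₗᵢ[ℝ] Euc n, ∫ y, K.indicator f (V y) ≤ M) :
    densityMeasure f K ≤ n / (n - k) * cConst n k * M * vol D ^ ((k : ℝ) / n) := by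
  have hn : (0 : ℝ) < n := by exact_mod_cast (by omega : 0 < n)
  have hnk : (0 : ℝ) < n - k := sub_pos.2 (by exact_mod_cast hk)
  have hd0 : 0 ≤ densityMeasure f K := setIntegral_nonneg hK.measurableSet hf0
  have hM' (V : Euc (n - k) →ₗᵢ[ℝ] Euc n) :
      ∫⁻ y, ENNReal.ofReal (K.indicator f (V y)) ≤ ENNReal.ofReal M := by
    rw [← ofReal_integral_eq_lintegral_ofReal (integrable_indicator_comp volume hK hf V)
      (ae_of_all _ fun y => indicator_nonneg hf0 _)]
    exact ENNReal.ofReal_le_ofReal (hM V)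
  have hle := (mul_le_mul_right (mul_le_mul_right
    (ofReal_densityMeasure_le_setLIntegral hKD hK hf hf0) _) _).trans
    (hD.volume_closedBall_mul_setLIntegral_le hk1 hk
      (measurable_indicator_of_continuousOn hf hK.measurableSet).ennreal_ofReal hM')
  have hfinite {A : Set (Euc n)} (hA : Bornology.IsBounded A) {s : ℝ} (hs : 0 ≤ s) :
      (n * volume A) ^ s ≠ ∞ :=
    ENNReal.rpow_ne_top_of_nonneg hs
      (ENNReal.mul_ne_top (ENNReal.natCast_ne_top n) hA.measure_lt_top.ne)
  have hreal := ENNReal.toReal_mono (ENNReal.mul_ne_top ENNReal.ofReal_ne_top (ENNReal.mul_ne_top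
    (hfinite isBounded_closedBall (by positivity)) (hfinite hD.1.1.isBounded (by positivity)))) hle
  simp only [ENNReal.toReal_mul, ← ENNReal.toReal_rpow, ENNReal.toReal_natCast,
    ENNReal.toReal_ofReal hd0, ENNReal.toReal_ofReal hM0, Nat.cast_sub hk.le, ← vol.eq_def] at hreal
  rw [mul_rpow_sub_div_mul_mul_rpow_div (vol_nonneg _) (vol_nonneg _) hn] at hreal
  have hball : 0 < vol (closedBall (0 : Euc (n - k)) 1) :=
    (isSymmStarBody_closedBall one_pos).1.vol_pos
  rw [← mul_assoc, mul_comm _ (densityMeasure f K), ← le_div_iff₀ (mul_pos hnk hball)] at hreal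
  exact hreal.trans_eq (by rw [cConst]; field_simp)

theorem le_outerVolumeRatio_pow_mul (hK : Bornology.IsBounded K) {a C : ℝ}
    (h : ∀ D, K ⊆ D → IsGenIntersectionBody k D → a ≤ ((vol D / vol K) ^ (1 / (n : ℝ))) ^ k * C) :
    a ≤ outerVolumeRatio k K ^ k * C := by
  obtain ⟨R, hR, hKR⟩ := hK.exists_pos_norm_le
  have hmem : outerVolumeRatio k K ∈ closure {v : ℝ | ∃ D : Set (Euc n), K ⊆ D ∧
      IsGenIntersectionBody k D ∧ v = (vol D / vol K) ^ (1 / (n : ℝ))} := by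
    refine csInf_mem_closure ⟨_, closedBall 0 R, fun x hx => ?_,
      isGenIntersectionBody_closedBall k hR, rfl⟩ ⟨0, ?_⟩
    · exact mem_closedBall_zero_iff.2 (hKR x hx)
    · rintro _ ⟨D, -, -, rfl⟩
      exact Real.rpow_nonneg (div_nonneg (vol_nonneg D) (vol_nonneg K)) _
  refine closure_minimal ?_ (isClosed_le continuous_const (by fun_prop)) hmem
    (t := {v : ℝ | a ≤ v ^ k * C})
  rintro _ ⟨D, hKD, hD, rfl⟩
  exact h D hKD hD

theorem div_rpow_one_div_pow_mul_rpow_div {v w : ℝ} (hv : 0 ≤ v) (hw : 0 < w) (n : ℝ) (k : ℕ) :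
    ((v / w) ^ (1 / n)) ^ k * w ^ (k / n) = v ^ (k / n) := by
  rw [← Real.rpow_natCast, ← Real.rpow_mul (by positivity), one_div_mul_eq_div,
    ← Real.mul_rpow (by positivity) hw.le, div_mul_cancel₀ v hw.ne']

theorem corollary1_general (n k : ℕ) (hk : 1 ≤ k) (hkn : k < n) (K : Set (Euc n))
    (hK : IsStarBody K) (f : Euc n → ℝ) (hf_cont : ContinuousOn f K)
    (hf_nonneg : ∀ x ∈ K, 0 ≤ f x) :
    ∃ M : ℝ,
      IsGreatest {s : ℝ | ∃ H : Submodule ℝ (Euc n),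
        finrank ℝ H = n - k ∧ s = sectionMeasure f K H} M ∧
      densityMeasure f K ≤
        outerVolumeRatio k K ^ k * ((n : ℝ) / ((n : ℝ) - (k : ℝ))) * cConst n k * M *
          vol K ^ ((k : ℝ) / (n : ℝ)) := by
  obtain ⟨M, hM⟩ := hK.exists_isGreatest_sectionMeasure hf_cont (Nat.sub_le n k)
  have hMV (V : Euc (n - k) →ₗᵢ[ℝ] Euc n) : ∫ y, K.indicator f (V y) ≤ M :=
    hM.2 ⟨_, by rw [LinearMap.finrank_range_of_inj V.injective, finrank_euclideanSpace_fin],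
      (sectionMeasure_range_eq_integral f hK.isClosed.measurableSet V).symm⟩
  have hM0 : 0 ≤ M := by
    obtain ⟨H, -, rfl⟩ := hM.1
    exact setIntegral_nonneg (measurable_subtype_coe hK.isClosed.measurableSet)
      fun x hx => hf_nonneg x hx
  have hmain : densityMeasure f K ≤ outerVolumeRatio k K ^ k *
      (n / (n - k) * cConst n k * M * vol K ^ ((k : ℝ) / n)) := by
    refine le_outerVolumeRatio_pow_mul hK.isBounded fun D hKD hD => ?_
    calc densityMeasure f K ≤ n / (n - k) * cConst n k * M * vol D ^ ((k : ℝ) / n) :=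
          hD.densityMeasure_le hk hkn hKD hK.isCompact hf_cont hf_nonneg hM0 hMV
      _ = _ := by
          rw [← div_rpow_one_div_pow_mul_rpow_div (vol_nonneg D) hK.vol_pos n k]
          exact mul_left_comm _ _ _
  exact ⟨M, hM, by simpa only [mul_assoc] using hmain⟩

end VolumeEstimate

end

theorem corollary1 (n k : ℕ) (hk : 1 ≤ k) (hkn : k ≤ n - 1)
    (K : Set (Euc n)) (hK : IsSymmStarBody K)
    (f : Euc n → ℝ) (hf_cont : ContinuousOn f K)
    (hf_nonneg : ∀ x ∈ K, 0 ≤ f x) (hf_even : ∀ x ∈ K, f (-x) = f x) :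
    ∃ M : ℝ,
      IsGreatest {s : ℝ | ∃ H : Submodule ℝ (Euc n),
        Module.finrank ℝ H = n - k ∧ s = sectionMeasure f K H} M ∧
      densityMeasure f K ≤
        outerVolumeRatio k K ^ k * ((n : ℝ) / ((n : ℝ) - (k : ℝ))) * cConst n k * M *
          vol K ^ ((k : ℝ) / (n : ℝ)) :=
  corollary1_general n k hk (by omega) K hK.1 f hf_cont hf_nonneg
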